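/- Let $\mathcal X_0$ and $\mathcal X$ be finite totally ordered sets, $\mathbb K$ a field, and $\mathfrak R=\mathbb K[p_{ix} : i\in\mathcal X_0,\ x\in\mathcal X]$. Equip $\mathfrak R$ with the lexicographic monomial order induced by the ordering of the variables in which $p_{ix}>p_{jy}$ if and only if $i>j$, or $i=j$ and $x>y$. For $i,j\in\mathcal X_0$ and $x,y\in\mathcal X$ put $f^{ij}_{xy}=p_{ix}p_{jy}-p_{iy}p_{jx}$. For a simple graph $G$ with vertex set $\mathcal X$ let $I_G\subseteq\mathfrak R$ be the ideal generated by all $f^{ij}_{xy}$ with $i,j\in\mathcal X_0$ and $(x,y)$ an edge of $G$ (the generalized binomial edge ideal). A path $\pi: x=x_0,x_1,\dots,x_r=y$ in $G$ is called admissible if (i) the vertices $x_0,\dots,x_r$ are pairwise distinct and $x<y$; (ii) for each $k=1,\dots,r-1$ either $x_k<x$ or $x_k>y$; (iii) for every proper subset $\{y_1,\dots,y_s\}$ of $\{x_1,\dots,x_{r-1}\}$ the sequence $x,y_1,\dots,y_s,y$ is not a path in $G$. A function $\kappa:\{0,\dots,r\}\to\mathcal X_0$ is called strictly $\pi$-antitone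 if $\kappa(0)>\kappa(r)$ and, for all $0\le s,t\le r$, $x_s<x_t$ implies $\kappa(s)\ge\kappa(t)$. Put $u_\pi^\kappa=\prod_{k=1}^{r-1}p_{\kappa(k)x_k}$, and write $\kappa(x)=\kappa(0)$, $\kappa(y)=\kappa(r)$. Theorem. The set of binomials $$\mathcal G=\left\{\,u_\pi^\kappa f_{xy}^{\kappa(y)\kappa(x)} \;:\; x<y,\ \pi\text{ an admissible path in }G\text{ from }x\text{ to }y,\ \kappa\text{ strictly }\pi\text{-antitone}\right\}$$ is a reduced Gröbner basis of $I_G$ with respect to the above monomial order. That is, $\mathcal G$ is a finite subset of $I_G$, the leading terms of the elements of $\mathcal G$ generate the ideal generated by the leading terms of all elements of $I_G$, every element of $\mathcal G$ has leading coefficient $1$, and no monomial occurring in an element $g\in\mathcal G$ is divisible by the leading monomial of another element of $\mathcal G$. -/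

import Mathlib

open MvPolynomial

namespace GroebnerBasis

variable {σ K : Type*} [Field K]

/-- `B` is a Gröbner basis of the ideal `I` with respect to the monomial order `m`: a finite subset
of `I` whose leading terms generate the initial ideal of `I` (the ideal generated by the leading
terms of all elements of `I`). -/
def IsGroebnerBasis (m : MonomialOrder σ) (I : Ideal (MvPolynomial σ K))
    (B : Set (MvPolynomial σ K)) : Prop :=
  B.Finite ∧ B ⊆ (I : Set (MvPolynomial σ K)) ∧
    Ideal.span (m.leadingTerm '' B) = Ideal.span (m.leadingTerm '' (I : Set (MvPolynomial σ K)))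

/-- `B` is a reduced Gröbner basis of `I`: a Gröbner basis in which all leading coefficients are `1`
and in which no monomial occurring in some `g ∈ B` is divisible by the leading monomial of another
element `h ∈ B`. (Divisibility of monomials is the pointwise order `≤` of exponent vectors.) -/
def IsReducedGroebnerBasis (m : MonomialOrder σ) (I : Ideal (MvPolynomial σ K))
    (B : Set (MvPolynomial σ K)) : Prop :=
  IsGroebnerBasis m I B ∧
    (∀ g ∈ B, m.leadingCoeff g = 1) ∧
    ∀ g ∈ B, ∀ h ∈ B, h ≠ g → ∀ d ∈ g.support, ¬ m.degree h ≤ d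

end GroebnerBasis

namespace BinomialEdge

variable {X₀ V : Type*}

/-- Index type of the unknowns `p_{ix}`, `i ∈ X₀`, `x ∈ V`: pairs `(i, x)`, ordered
lexicographically with the order then reversed. In `MonomialOrder.lex` a *smaller* index gives a
*larger* variable; with the reversal, `p_{ix} > p_{jy}` iff `i > j`, or `i = j` and `x > y`. -/
abbrev Var (X₀ V : Type*) : Type _ := (X₀ ×ₗ V)ᵒᵈ

variable (K : Type*) [Field K]

/-- The unknown `p_{ix}`. -/
noncomputable def p (i : X₀) (x : V) : MvPolynomial (Var X₀ V) K :=
  X (OrderDual.toDual (toLex (i, x)))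

/-- The binomial `f^{ij}_{xy} = p_{ix} p_{jy} - p_{iy} p_{jx}`. -/
noncomputable def f (i j : X₀) (x y : V) : MvPolynomial (Var X₀ V) K :=
  p K i x * p K j y - p K i y * p K j x

/-- The generalized binomial edge ideal `I_G`. -/
noncomputable def edgeIdeal (X₀ : Type*) (G : SimpleGraph V) :
    Ideal (MvPolynomial (Var X₀ V) K) :=
  Ideal.span {q | ∃ (i j : X₀) (x y : V), G.Adj x y ∧ q = f K i j x y}

/-- A path `π : x = x₀, x₁, …, x_r = y` is admissible if its vertices are distinct and `x < y`,
each inner vertex is `< x` or `> y`, and no path from `x` to `y` uses only a proper subset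
of the vertices of `π`. (As the vertices of `π` are distinct, and `x`, `y` lie on both paths, this is
the same as using only a proper subset of the inner vertices.) -/
structure IsAdmissible [LinearOrder V] {G : SimpleGraph V} {x y : V} (π : G.Walk x y) : Prop where
  isPath : π.IsPath
  lt : x < y
  inner : ∀ k, 0 < k → k < π.length → π.getVert k < x ∨ y < π.getVert k
  minimal : ∀ τ : G.Walk x y, τ.IsPath → ¬ {v | v ∈ τ.support} ⊂ {v | v ∈ π.support}

/-- `κ : {0, …, r} → X₀` is `π`-antitone: `x_s < x_t` implies `κ(s) ≥ κ(t)`. -/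
def IsAntitone [LinearOrder X₀] [LinearOrder V] {G : SimpleGraph V} {x y : V} (π : G.Walk x y)
    (κ : Fin (π.length + 1) → X₀) : Prop :=
  ∀ s t : Fin (π.length + 1), π.getVert s < π.getVert t → κ t ≤ κ s

/-- `κ` is strictly `π`-antitone: it is `π`-antitone and `κ(0) > κ(r)`. -/
def IsStrictlyAntitone [LinearOrder X₀] [LinearOrder V] {G : SimpleGraph V} {x y : V}
    (π : G.Walk x y) (κ : Fin (π.length + 1) → X₀) : Prop :=
  IsAntitone π κ ∧ κ (Fin.last π.length) < κ 0

/-- The monomial `u_π^κ = ∏_{k=1}^{r-1} p_{κ(k) x_k}`. -/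
noncomputable def u {G : SimpleGraph V} {x y : V} (π : G.Walk x y)
    (κ : Fin (π.length + 1) → X₀) : MvPolynomial (Var X₀ V) K :=
  ∏ k ∈ Finset.Ioo 0 (Fin.last π.length), p K (κ k) (π.getVert k)

/-- The set of all binomials `u_π^κ f_{xy}^{κ(y)κ(x)}`, where `π` is an admissible path in `G` from
`x` to `y` and `κ` is strictly `π`-antitone. -/
def pathBinomials (X₀ : Type*) [LinearOrder X₀] [LinearOrder V] (G : SimpleGraph V) :
    Set (MvPolynomial (Var X₀ V) K) :=
  {q | ∃ (x y : V) (π : G.Walk x y) (κ : Fin (π.length + 1) → X₀),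
    IsAdmissible π ∧ IsStrictlyAntitone π κ ∧
      q = u K π κ * f K (κ (Fin.last π.length)) (κ 0) x y}

end BinomialEdge

/-! No S-pairs are needed. Expanding shows that a path binomial is a difference of two monomials,
each placing one label on every vertex of `π`. The trailing one, with labels `κ`, has no inversion,
that is, no `x < y` with labels `i < j`. The leading one, with the end labels exchanged, has an
inversion exactly at the two ends.

Gröbner basis: vertex degrees and, for each connected component of the occurring vertices, the label
counts are unchanged modulo the generators. Hence the coefficients of an element of the ideal sum to
zero over each class (`classSum_eq_zero`), and its leading monomial `m` shares its class with a
smaller monomial. Comparing the two yields an inversion of `m` inside one component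
(`exists_inversion_of_lt`). A shortest walk carrying an inversion is an admissible path whose
leading monomial divides `m` (`exists_placement_le`).

Reducedness: a leading monomial cannot divide an inversion-free monomial. If it divides another
leading monomial, the ends agree, and minimality of admissible paths makes the binomials equal. -/

namespace BinomialEdge

open scoped MonomialOrder

variable {X₀ V : Type*}

/-! ### Path binomials as differences of two labelled paths -/

/-- The index of the unknown `p_{ix}`. -/
abbrev var (i : X₀) (x : V) : Var X₀ V := OrderDual.toDual (toLex (i, x))

lemma var_inj {i j : X₀} {x y : V} : var i x = var j y ↔ i = j ∧ x = y := by
  simp [var]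

/-- The exponent vector of `∏_k p_{l(k) x_k}`, the product over all vertices of `π`. -/
noncomputable def placement {G : SimpleGraph V} {x y : V} (π : G.Walk x y)
    (l : Fin (π.length + 1) → X₀) : Var X₀ V →₀ ℕ :=
  ∑ k, Finsupp.single (var (l k) (π.getVert k)) 1

/-- `κ` with its values at the two ends exchanged. -/
def swapEnds {n : ℕ} (κ : Fin (n + 1) → X₀) : Fin (n + 1) → X₀ :=
  κ ∘ Equiv.swap 0 (Fin.last n)

@[simp] lemma swapEnds_zero {n : ℕ} (κ : Fin (n + 1) → X₀) : swapEnds κ 0 = κ (Fin.last n) := by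
  simp [swapEnds]

@[simp] lemma swapEnds_last {n : ℕ} (κ : Fin (n + 1) → X₀) : swapEnds κ (Fin.last n) = κ 0 := by
  simp [swapEnds]

lemma swapEnds_of_ne {n : ℕ} (κ : Fin (n + 1) → X₀) {k : Fin (n + 1)} (h₀ : k ≠ 0)
    (h₁ : k ≠ Fin.last n) : swapEnds κ k = κ k := by
  simp [swapEnds, Equiv.swap_apply_of_ne_of_ne h₀ h₁]

lemma univ_eq_insert_ends (n : ℕ) :
    (Finset.univ : Finset (Fin (n + 1))) =
      insert 0 (insert (Fin.last n) (Finset.Ioo 0 (Fin.last n))) := by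
  ext k
  simp only [Finset.mem_univ, Finset.mem_insert, Finset.mem_Ioo, true_iff]
  rcases eq_or_ne k 0 with h | h
  · exact Or.inl h
  · rcases eq_or_ne k (Fin.last n) with h' | h'
    · exact Or.inr (Or.inl h')
    · exact Or.inr (Or.inr ⟨Fin.pos_iff_ne_zero.2 h, Fin.lt_last_iff_ne_last.2 h'⟩)

section

variable {G : SimpleGraph V} {x y : V} (π : G.Walk x y)

lemma placement_eq_add (hxy : x ≠ y) {κ l : Fin (π.length + 1) → X₀}
    (h : ∀ k ∈ Finset.Ioo 0 (Fin.last π.length), l k = κ k) :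
    placement π l = (∑ k ∈ Finset.Ioo 0 (Fin.last π.length),
      Finsupp.single (var (κ k) (π.getVert k)) 1) +
      (Finsupp.single (var (l 0) x) 1 + Finsupp.single (var (l (Fin.last _)) y) 1) := by
  have h0 : (0 : Fin (π.length + 1)) ≠ Fin.last π.length := by
    intro h
    have := π.eq_of_length_eq_zero (by simpa [Fin.ext_iff] using h.symm)
    exact hxy this
  rw [placement, univ_eq_insert_ends, Finset.sum_insert (by simp [h0]), Finset.sum_insert (by simp),
    Finset.sum_congr rfl fun k hk => by rw [h k hk]]
  simp only [Fin.val_zero, SimpleGraph.Walk.getVert_zero, Fin.val_last,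
    SimpleGraph.Walk.getVert_length]
  abel

variable (K : Type*) [Field K]

lemma u_mul_ends (hxy : x ≠ y) {κ l : Fin (π.length + 1) → X₀}
    (h : ∀ k ∈ Finset.Ioo 0 (Fin.last π.length), l k = κ k) :
    u K π κ * (p K (l 0) x * p K (l (Fin.last _)) y) = monomial (placement π l) 1 := by
  rw [placement_eq_add π hxy h, ← mul_one (1 : K), ← monomial_mul, ← mul_one (1 : K),
    ← monomial_mul, mul_one, monomial_sum_one]
  rfl

lemma swapEnds_eq_of_mem_Ioo {n : ℕ} (κ : Fin (n + 1) → X₀) :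
    ∀ k ∈ Finset.Ioo 0 (Fin.last n), swapEnds κ k = κ k := by
  intro k hk
  rw [Finset.mem_Ioo] at hk
  exact swapEnds_of_ne κ hk.1.ne' hk.2.ne

lemma u_mul_f (hxy : x ≠ y) (κ : Fin (π.length + 1) → X₀) :
    u K π κ * f K (κ (Fin.last π.length)) (κ 0) x y =
      monomial (placement π (swapEnds κ)) 1 - monomial (placement π κ) 1 := by
  rw [← u_mul_ends π K hxy (swapEnds_eq_of_mem_Ioo κ), ← u_mul_ends π K hxy (fun _ _ => rfl),
    swapEnds_zero, swapEnds_last, f]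
  ring

end

/-! ### Leading terms of path binomials -/

section Order

variable [LinearOrder X₀] [LinearOrder V] [Finite X₀] [Finite V]

/-- The largest of the four unknowns is `p_{jy}`, and it occurs only on the right. -/
lemma swap_lt {i j : X₀} {x y : V} (hij : i < j) (hxy : x < y) :
    (Finsupp.single (var j x) 1 + Finsupp.single (var i y) 1) ≺[MonomialOrder.lex]
      (Finsupp.single (var i x) 1 + Finsupp.single (var j y) 1) := by
  rw [MonomialOrder.lex_lt_iff, Finsupp.Lex.lt_iff]
  refine ⟨var j y, fun v hv => ?_, ?_⟩
  · have h : ∀ (k : X₀) (z : V), toLex (k, z) ≤ toLex (j, y) → var k z ≠ v := by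
      rintro k z h rfl
      exact absurd (OrderDual.toDual_lt_toDual.1 hv) (not_lt.2 h)
    simp only [ofLex_toLex, Finsupp.add_apply]
    rw [Finsupp.single_eq_of_ne' (h _ _ ?_), Finsupp.single_eq_of_ne' (h _ _ ?_),
      Finsupp.single_eq_of_ne' (h _ _ ?_), Finsupp.single_eq_of_ne' (h _ _ ?_)] <;>
      simp [Prod.Lex.toLex_le_toLex, hij, hxy.le]
  · simp [hij.ne, hxy.ne]

variable {G : SimpleGraph V} {x y : V} (π : G.Walk x y)

lemma placement_lt (hxy : x < y) {κ : Fin (π.length + 1) → X₀} (h : κ (Fin.last _) < κ 0) :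
    placement π κ ≺[MonomialOrder.lex] placement π (swapEnds κ) := by
  rw [placement_eq_add π hxy.ne (swapEnds_eq_of_mem_Ioo κ),
    placement_eq_add π hxy.ne (fun _ _ => rfl), map_add, map_add, swapEnds_zero, swapEnds_last]
  exact add_lt_add_right (swap_lt h hxy) _

variable (K : Type*) [Field K]

lemma degree_u_mul_f (hxy : x < y) {κ : Fin (π.length + 1) → X₀} (h : κ (Fin.last _) < κ 0) :
    MonomialOrder.lex.degree (u K π κ * f K (κ (Fin.last π.length)) (κ 0) x y) =
      placement π (swapEnds κ) := by
  classical
  rw [u_mul_f π K hxy.ne, MonomialOrder.degree_sub_of_lt] <;>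
    simp only [MonomialOrder.degree_monomial, one_ne_zero, if_false]
  exact placement_lt π hxy h

lemma leadingCoeff_u_mul_f (hxy : x < y) {κ : Fin (π.length + 1) → X₀}
    (h : κ (Fin.last _) < κ 0) :
    MonomialOrder.lex.leadingCoeff (u K π κ * f K (κ (Fin.last π.length)) (κ 0) x y) = 1 := by
  classical
  rw [u_mul_f π K hxy.ne, MonomialOrder.leadingCoeff_sub_of_lt, MonomialOrder.leadingCoeff_monomial]
  simp only [MonomialOrder.degree_monomial, one_ne_zero, if_false]
  exact placement_lt π hxy h

end Order

section

variable {G : SimpleGraph V} {x y : V} {π : G.Walk x y}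

lemma placement_ne_zero_iff {l : Fin (π.length + 1) → X₀} {i : X₀} {z : V} :
    placement π l (var i z) ≠ 0 ↔ ∃ k, l k = i ∧ π.getVert k = z := by
  classical
  simp [placement, Finsupp.finsetSum_apply, Finsupp.single_apply]

/-- The vertices of a path are distinct, so its placement is squarefree and divisibility can be
tested on supports. -/
lemma placement_le (hπ : π.IsPath) {l : Fin (π.length + 1) → X₀} {d : Var X₀ V →₀ ℕ}
    (h : ∀ k, d (var (l k) (π.getVert k)) ≠ 0) : placement π l ≤ d := by
  classical
  intro v
  by_cases hv : ∃ k, var (l k) (π.getVert k) = v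
  · obtain ⟨k, rfl⟩ := hv
    refine le_trans ?_ (Nat.one_le_iff_ne_zero.2 (h k))
    rw [placement, Finsupp.finsetSum_apply, Finset.sum_eq_single k]
    · simp
    · intro k' _ hk'
      refine Finsupp.single_eq_of_ne' fun e => hk' (Fin.ext ?_)
      exact hπ.getVert_injOn (Nat.lt_succ_iff.1 k'.2) (Nat.lt_succ_iff.1 k.2) (var_inj.1 e).2
    · simp
  · rw [placement, Finsupp.finsetSum_apply, Finset.sum_eq_zero]
    · exact Nat.zero_le _
    · intro k _
      exact Finsupp.single_eq_of_ne' fun e => hv ⟨k, e⟩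

end

/-! ### Path binomials lie in the ideal and are finite in number -/

section Membership

variable (K : Type*) [Field K] {G : SimpleGraph V}

/-- Membership holds for arbitrary labels; antitonicity matters only for the Gröbner property.
Indexing by `ℕ` lets the induction drop the last vertex without changing the type of the walk. -/
lemma prod_mul_f_mem (w : ℕ → V) (κ : ℕ → X₀) (n : ℕ) (hw : ∀ k < n + 1, G.Adj (w k) (w (k + 1)))
    (i j : X₀) :
    (∏ k ∈ Finset.Ioo 0 (n + 1), p K (κ k) (w k)) * f K i j (w 0) (w (n + 1)) ∈
      edgeIdeal K X₀ G := by
  induction n generalizing i j with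
  | zero =>
    refine Ideal.mul_mem_left _ _ (Ideal.subset_span ⟨i, j, _, _, hw 0 (by simp), rfl⟩)
  | succ n ih =>
    have hI : Finset.Ioo 0 (n + 1 + 1) = insert (n + 1) (Finset.Ioo 0 (n + 1)) := by
      ext; simp
    rw [hI, Finset.prod_insert (by simp)]
    set P := ∏ k ∈ Finset.Ioo 0 (n + 1), p K (κ k) (w k)
    have hf : ∀ a b : X₀, f K a b (w (n + 1)) (w (n + 2)) ∈ edgeIdeal K X₀ G := fun a b =>
      Ideal.subset_span ⟨a, b, _, _, hw (n + 1) (by simp), rfl⟩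
    -- The exchange of labels between the ends is done in three moves through `w (n + 1)`: two along
    -- the last edge, one along the shorter walk.
    have key : p K (κ (n + 1)) (w (n + 1)) * P * f K i j (w 0) (w (n + 1 + 1)) =
        P * p K i (w 0) * f K (κ (n + 1)) j (w (n + 1)) (w (n + 2)) +
        p K (κ (n + 1)) (w (n + 2)) * (P * f K i j (w 0) (w (n + 1))) +
        P * p K j (w 0) * f K i (κ (n + 1)) (w (n + 1)) (w (n + 2)) := by
      simp only [f]
      ring
    rw [key]
    exact add_mem (add_mem (Ideal.mul_mem_left _ _ (hf _ _))
      (Ideal.mul_mem_left _ _ (ih (fun k hk => hw k (by omega)) i j)))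
      (Ideal.mul_mem_left _ _ (hf _ _))

lemma u_mul_f_mem {x y : V} (hxy : x ≠ y) (π : G.Walk x y) (κ : Fin (π.length + 1) → X₀)
    (i j : X₀) : u K π κ * f K i j x y ∈ edgeIdeal K X₀ G := by
  obtain ⟨n, hn⟩ : ∃ n, π.length = n + 1 :=
    Nat.exists_eq_succ_of_ne_zero fun h => hxy (π.eq_of_length_eq_zero h)
  have h := prod_mul_f_mem (X₀ := X₀) (G := G) K π.getVert (fun k => κ (Fin.ofNat _ k)) n
    (fun k hk => π.adj_getVert_succ (by omega)) i j
  rw [← hn, π.getVert_zero, π.getVert_length] at h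
  convert h using 2
  have hI : Finset.Ioo 0 π.length =
      (Finset.Ioo 0 (Fin.last π.length)).map Fin.valEmbedding := by
    simp
  rw [hI, Finset.prod_map]
  simp [u]

lemma pathBinomials_finite [LinearOrder X₀] [LinearOrder V] [Finite X₀] [Finite V] :
    (pathBinomials K X₀ G).Finite := by
  have := Fintype.ofFinite V
  let F : (Σ n : Fin (Fintype.card V), (Fin (n + 1) → V) × (Fin (n + 1) → X₀)) →
      MvPolynomial (Var X₀ V) K := fun s =>
    (∏ k ∈ Finset.Ioo 0 (Fin.last _), p K (s.2.2 k) (s.2.1 k)) *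
      f K (s.2.2 (Fin.last _)) (s.2.2 0) (s.2.1 0) (s.2.1 (Fin.last _))
  refine (Set.finite_range F).subset ?_
  rintro _ ⟨x, y, π, κ, hπ, -, rfl⟩
  refine ⟨⟨⟨π.length, hπ.isPath.length_lt⟩, fun k => π.getVert k, κ⟩, ?_⟩
  simp [F, u]

end Membership

end BinomialEdge

/-! ### Invariants of monomials modulo the ideal -/

namespace BinomialEdge

open scoped MonomialOrder

variable {X₀ V : Type*}

/-- `z` and `y` are joined by a walk in `G` all of whose vertices lie in `W`. -/
def Joined (G : SimpleGraph V) (W : Set V) (z y : V) : Prop :=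
  ∃ w : G.Walk z y, ∀ v ∈ w.support, v ∈ W

lemma Joined.symm {G : SimpleGraph V} {W : Set V} {z y : V} (h : Joined G W z y) :
    Joined G W y z := by
  obtain ⟨w, hw⟩ := h
  exact ⟨w.reverse, fun v hv => hw v (by simpa using hv)⟩

lemma Joined.trans {G : SimpleGraph V} {W : Set V} {z y x : V} (h : Joined G W z y)
    (h' : Joined G W y x) : Joined G W z x := by
  obtain ⟨w, hw⟩ := h
  obtain ⟨w', hw'⟩ := h'
  refine ⟨w.append w', fun v hv => ?_⟩
  rcases (SimpleGraph.Walk.mem_support_append_iff _ _).1 hv with h | h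
  exacts [hw v h, hw' v h]

lemma Joined.of_adj {G : SimpleGraph V} {W : Set V} {z y : V} (h : G.Adj z y) (hz : z ∈ W)
    (hy : y ∈ W) : Joined G W z y :=
  ⟨h.toWalk, by simp [hz, hy]⟩

lemma Joined.refl (G : SimpleGraph V) {W : Set V} {z : V} (hz : z ∈ W) : Joined G W z z :=
  ⟨.nil, by simp [hz]⟩

section Invariant

variable [Fintype X₀] [Fintype V]

/-- The degree of a monomial in the unknowns `p_{ix}`, `i ∈ X₀`, for each `x`. -/
def vertexDegree (d : Var X₀ V →₀ ℕ) (x : V) : ℕ := ∑ i, d (var i x)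

/-- The vertices occurring in a monomial with given vertex degrees. -/
abbrev occurring (r : V → ℕ) : Set V := {x | r x ≠ 0}

open Classical in
/-- The degree of a monomial in the unknowns `p_{iy}`, with `y` in the connected component of `z`
among the occurring vertices. -/
noncomputable def componentDegree (G : SimpleGraph V) (d : Var X₀ V →₀ ℕ) (z : V) (i : X₀) : ℕ :=
  ∑ y with Joined G (occurring (vertexDegree d)) z y, d (var i y)

/-- The vertex degrees and component degrees of a monomial; they only depend on its class modulo
the binomials generating the ideal of `G`. -/
noncomputable def invariant (G : SimpleGraph V) (d : Var X₀ V →₀ ℕ) : (V → ℕ) × (V → X₀ → ℕ) :=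
  (vertexDegree d, componentDegree G d)

omit [Fintype V] in
lemma vertexDegree_add (d e : Var X₀ V →₀ ℕ) :
    vertexDegree (d + e) = vertexDegree d + vertexDegree e := by
  ext x
  simp [vertexDegree, Finset.sum_add_distrib]

omit [Fintype X₀] [Fintype V] in
open Classical in
lemma single_var_apply (i k : X₀) (x y : V) :
    (Finsupp.single (var i x) 1 : Var X₀ V →₀ ℕ) (var k y) = if i = k ∧ x = y then 1 else 0 := by
  simp only [Finsupp.single_apply, var_inj]

omit [Fintype V] in
open Classical in
lemma vertexDegree_single (i : X₀) (x y : V) :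
    vertexDegree (Finsupp.single (var i x) 1 : Var X₀ V →₀ ℕ) y = if x = y then 1 else 0 := by
  simp only [vertexDegree, single_var_apply]
  by_cases h : x = y <;> simp [h]

omit [Fintype X₀] [Fintype V] in
open Classical in
lemma sum_single_var (s : Finset V) (i k : X₀) (x : V) :
    ∑ y ∈ s, (Finsupp.single (var i x) 1 : Var X₀ V →₀ ℕ) (var k y) =
      if i = k ∧ x ∈ s then 1 else 0 := by
  simp only [single_var_apply]
  by_cases h : i = k <;> simp [h]

/-- Both ends of the edge occur in the monomial, so a component contains both or neither, and
exchanging their labels does not change its label counts. -/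
lemma invariant_swap {G : SimpleGraph V} (t : Var X₀ V →₀ ℕ) (i j : X₀) {x y : V}
    (h : G.Adj x y) :
    invariant G (t + (Finsupp.single (var i x) 1 + Finsupp.single (var j y) 1)) =
      invariant G (t + (Finsupp.single (var i y) 1 + Finsupp.single (var j x) 1)) := by
  classical
  have hr : vertexDegree (t + (Finsupp.single (var i x) 1 + Finsupp.single (var j y) 1)) =
      vertexDegree (t + (Finsupp.single (var i y) 1 + Finsupp.single (var j x) 1)) := by
    ext z
    simp only [vertexDegree_add, Pi.add_apply, vertexDegree_single]
    omega
  refine Prod.ext hr ?_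
  funext z k
  simp only [invariant, componentDegree]
  rw [← hr]
  set r := vertexDegree (t + (Finsupp.single (var i x) 1 + Finsupp.single (var j y) 1)) with hrdef
  have hx : x ∈ occurring r := by
    simp [r, vertexDegree_add, vertexDegree_single]
  have hy : y ∈ occurring r := by
    simp [r, vertexDegree_add, vertexDegree_single]
  have hxy : Joined G (occurring r) z x ↔ Joined G (occurring r) z y :=
    ⟨fun h' => h'.trans (.of_adj h hx hy), fun h' => h'.trans (.of_adj h.symm hy hx)⟩
  simp only [Finsupp.add_apply, Finset.sum_add_distrib, sum_single_var, Finset.mem_filter,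
    Finset.mem_univ, true_and, hxy]

variable {K : Type*} [Field K]

open Classical in
/-- The sum of the coefficients of the monomials with invariant `c`. -/
noncomputable def classSum (K : Type*) [Field K] (G : SimpleGraph V)
    (c : (V → ℕ) × (V → X₀ → ℕ)) : MvPolynomial (Var X₀ V) K →ₗ[K] K :=
  (basisMonomials (Var X₀ V) K).constr K fun d => if invariant G d = c then 1 else 0

open Classical in
lemma classSum_monomial (G : SimpleGraph V) (c : (V → ℕ) × (V → X₀ → ℕ)) (d : Var X₀ V →₀ ℕ)
    (a : K) : classSum K G c (monomial d a) = if invariant G d = c then a else 0 := by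
  have h : monomial d a = a • basisMonomials (Var X₀ V) K d := by
    simp [smul_monomial]
  rw [h, map_smul, classSum, Module.Basis.constr_basis]
  simp

lemma classSum_eq_zero {G : SimpleGraph V} (c : (V → ℕ) × (V → X₀ → ℕ))
    {g : MvPolynomial (Var X₀ V) K} (hg : g ∈ edgeIdeal K X₀ G) : classSum K G c g = 0 := by
  classical
  -- `classSum` is only `K`-linear; quantifying over multipliers makes the property stable under
  -- ideal operations and reduces generators to monomial multiples.
  suffices h : ∀ a : MvPolynomial (Var X₀ V) K, classSum K G c (a * g) = 0 by
    simpa using h 1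
  induction hg using Submodule.span_induction with
  | zero => simp
  | add q q' _ _ hq hq' => intro a; rw [mul_add, map_add, hq, hq', add_zero]
  | smul b q _ hq => intro a; rw [smul_eq_mul, ← mul_assoc, hq]
  | mem q hq =>
    obtain ⟨i, j, x, y, h, rfl⟩ := hq
    intro a
    induction a using MvPolynomial.induction_on' with
    | monomial t b =>
      simp only [f, p, X, mul_sub, monomial_mul, map_sub, classSum_monomial, mul_one,
        invariant_swap t i j h, sub_self]
    | add a b ha hb => rw [add_mul, map_add, ha, hb, add_zero]

/-- Were `m` alone in its class, the class sum would be its nonzero coefficient. -/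
lemma exists_mem_support_ne {G : SimpleGraph V} {g : MvPolynomial (Var X₀ V) K}
    (hg : g ∈ edgeIdeal K X₀ G) {m : Var X₀ V →₀ ℕ} (hm : m ∈ g.support) :
    ∃ n ∈ g.support, n ≠ m ∧ invariant G n = invariant G m := by
  classical
  by_contra! h
  have h0 := classSum_eq_zero (invariant G m) hg
  rw [g.as_sum, map_sum, Finset.sum_eq_single m, classSum_monomial, if_pos rfl] at h0
  · exact (mem_support_iff.1 hm) h0
  · intro n hn hnm
    rw [classSum_monomial, if_neg (h n hn hnm)]
  · exact fun h => absurd hm h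

/-- Let `p_{jy}` be the largest unknown whose exponents differ; it is more frequent in `m`. Equal
component degrees for `j` force a compensating deficit of `m` at some `p_{jz}` in the component of
`y`, and equal vertex degrees at `z` force an excess at some `p_{iz}`. By the choice of `p_{jy}`, `z
< y` and `i < j`. -/
lemma exists_inversion_of_lt [LinearOrder X₀] [LinearOrder V] {G : SimpleGraph V}
    {n m : Var X₀ V →₀ ℕ} (hnm : n ≺[MonomialOrder.lex] m) (h : invariant G n = invariant G m) :
    ∃ x y i j, x < y ∧ i < j ∧ m (var i x) ≠ 0 ∧ m (var j y) ≠ 0 ∧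
      Joined G (occurring (vertexDegree m)) x y := by
  classical
  obtain ⟨v, hv, hlt⟩ := Finsupp.Lex.lt_iff.1 (MonomialOrder.lex_lt_iff.1 hnm)
  obtain ⟨⟨j, y⟩, rfl⟩ : ∃ a : X₀ × V, v = var a.1 a.2 := ⟨ofLex (OrderDual.ofDual v), rfl⟩
  have hbig : ∀ k z, toLex (j, y) < toLex (k, z) → n (var k z) = m (var k z) := fun k z hk =>
    hv (var k z) (OrderDual.toDual_lt_toDual.2 hk)
  replace hlt : n (var j y) < m (var j y) := hlt
  have hr : vertexDegree n = vertexDegree m := congrArg Prod.fst h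
  have hc : componentDegree G n y j = componentDegree G m y j :=
    congrFun (congrFun (congrArg Prod.snd h) y) j
  rw [componentDegree, componentDegree, hr] at hc
  have hmj : m (var j y) ≠ 0 := (Nat.zero_le _).trans_lt hlt |>.ne'
  have hy : y ∈ occurring (vertexDegree m) := fun h0 =>
    hmj (Finset.sum_eq_zero_iff.1 h0 j (Finset.mem_univ _))
  obtain ⟨z, hz, hzlt⟩ : ∃ z, Joined G (occurring (vertexDegree m)) y z ∧
      m (var j z) < n (var j z) := by
    by_contra! hcon
    refine hc.not_lt (Finset.sum_lt_sum (fun z hz => hcon z (by simpa using hz)) ⟨y, ?_, hlt⟩)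
    simpa using Joined.refl G hy
  have hzy : z < y := by
    rcases lt_trichotomy z y with h' | rfl | h'
    · exact h'
    · exact absurd hzlt hlt.not_gt
    · exact absurd (hbig j z (by simp [Prod.Lex.toLex_lt_toLex, h'])) hzlt.ne'
  obtain ⟨i, hi⟩ : ∃ i, n (var i z) < m (var i z) := by
    by_contra! hcon
    exact (congrFun hr z).not_gt
      (Finset.sum_lt_sum (fun i _ => hcon i) ⟨j, Finset.mem_univ _, hzlt⟩)
  have hij : i < j := by
    rcases lt_trichotomy i j with h' | rfl | h'
    · exact h'
    · exact absurd hzlt hi.not_gt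
    · exact absurd (hbig i z (by simp [Prod.Lex.toLex_lt_toLex, h'])) hi.ne
  exact ⟨z, y, i, j, hzy, hij, ((Nat.zero_le _).trans_lt hi).ne', hmj, hz.symm⟩

end Invariant

/-! ### Shortest inversions are admissible paths -/

section Inversion

variable {G : SimpleGraph V}

lemma exists_subwalk {x y : V} (π : G.Walk x y) {s t : ℕ} (hst : s ≤ t) (ht : t ≤ π.length) :
    ∃ w : G.Walk (π.getVert s) (π.getVert t), w.length = t - s ∧ w.support ⊆ π.support := by
  induction t, hst using Nat.le_induction with
  | base => exact ⟨.nil, by simp, by simp⟩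
  | succ t hst ih =>
    obtain ⟨w, hl, hw⟩ := ih (by omega)
    refine ⟨w.concat (π.adj_getVert_succ (by omega)), by simp [hl]; omega, ?_⟩
    rw [SimpleGraph.Walk.support_concat]
    intro v hv
    rw [List.mem_append, List.mem_singleton] at hv
    rcases hv with h | rfl
    exacts [hw h, π.getVert_mem_support _]

variable [LinearOrder X₀] [LinearOrder V]

/-- Some walk of length `n`, all of whose vertices occur in the monomial `d`, has ends `x < y`
carrying values `i < j` in `d`. -/
def HasInversionOfLength (G : SimpleGraph V) (d : Var X₀ V →₀ ℕ) (n : ℕ) : Prop :=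
  ∃ (x y : V) (i j : X₀) (w : G.Walk x y), w.length = n ∧ (∀ v ∈ w.support, ∃ k, d (var k v) ≠ 0) ∧
    x < y ∧ i < j ∧ d (var i x) ≠ 0 ∧ d (var j y) ≠ 0

/-- All conditions on the path and its labels come from minimal length: any failure would exhibit an
inversion on a shorter walk. -/
lemma exists_placement_le {d : Var X₀ V →₀ ℕ} {N : ℕ} (hN : HasInversionOfLength G d N) :
    ∃ (x y : V) (π : G.Walk x y) (κ : Fin (π.length + 1) → X₀),
      IsAdmissible π ∧ IsStrictlyAntitone π κ ∧ placement π (swapEnds κ) ≤ d := by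
  classical
  have hmin : ∃ n, HasInversionOfLength G d n ∧ ∀ m < n, ¬ HasInversionOfLength G d m :=
    ⟨Nat.find ⟨N, hN⟩, Nat.find_spec ⟨N, hN⟩, fun m hm => Nat.find_min ⟨N, hN⟩ hm⟩
  obtain ⟨n, ⟨x, y, i, j, w, rfl, hocc, hxy, hij, hi, hj⟩, hmin⟩ := hmin
  obtain ⟨π, hπ, hlen, hsupp⟩ : ∃ π : G.Walk x y, π.IsPath ∧ π.length ≤ w.length ∧
      π.support ⊆ w.support :=
    ⟨w.bypass, w.bypass_isPath, w.length_bypass_le_length, w.support_bypass_subset_support⟩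
  replace hocc : ∀ v ∈ π.support, ∃ k, d (var k v) ≠ 0 := fun v hv => hocc v (hsupp hv)
  replace hmin : ∀ m < π.length, ¬ HasInversionOfLength G d m :=
    fun m hm => hmin m (hm.trans_le hlen)
  -- The labels at the ends are those of the inversion; elsewhere any label occurring in `d` will
  -- do.
  obtain ⟨c, hcx, hcy, hc⟩ : ∃ c : V → X₀, c x = i ∧ c y = j ∧
      ∀ v ∈ π.support, d (var (c v) v) ≠ 0 := by
    refine ⟨fun v => if v = x then i else if v = y then j else
      if h : v ∈ π.support then (hocc v h).choose else i, by simp, by simp [hxy.ne'], ?_⟩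
    intro v hv
    dsimp only
    split_ifs with h1 h2
    exacts [h1 ▸ hi, h2 ▸ hj, (hocc v hv).choose_spec]
  -- Because subtraction is truncated, the two strict bounds say that `s` and `t` are not the two
  -- ends of `π`, so the piece between them is shorter.
  have hanti : ∀ s t, s ≤ π.length → t ≤ π.length → t - s < π.length → s - t < π.length →
      π.getVert s < π.getVert t → c (π.getVert t) ≤ c (π.getVert s) := by
    intro s t hs ht hts hst hlt
    by_contra! hcon
    have hds := hc _ (π.getVert_mem_support s)
    have hdt := hc _ (π.getVert_mem_support t)
    rcases le_total s t with h | h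
    · obtain ⟨w', hl, hw'⟩ := exists_subwalk π h ht
      exact hmin _ hts ⟨_, _, _, _, w', hl, fun v hv => hocc v (hw' hv), hlt, hcon, hds, hdt⟩
    · obtain ⟨w', hl, hw'⟩ := exists_subwalk π h hs
      exact hmin _ hst ⟨_, _, _, _, w'.reverse, by simpa using hl,
        fun v hv => hocc v (hw' (by simpa using hv)), hlt, hcon, hds, hdt⟩
  have hx0 := π.getVert_zero
  have hyl := π.getVert_length
  -- An inner vertex strictly between `x` and `y` would have a label both at least `j` and at most
  -- `i`.
  have hinner : ∀ k, 0 < k → k < π.length →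
      (π.getVert k < x ∧ j ≤ c (π.getVert k)) ∨ (y < π.getVert k ∧ c (π.getVert k) ≤ i) := by
    intro k h0 hk
    have h1 := hanti 0 k (by omega) (by omega) (by omega) (by omega)
    have h2 := hanti k π.length (by omega) (by omega) (by omega) (by omega)
    rw [hx0, hcx] at h1
    rw [hyl, hcy] at h2
    have hkx : π.getVert k ≠ x := fun h => by
      have := hπ.getVert_injOn (x₁ := k) (x₂ := 0) hk.le (Nat.zero_le _) (h.trans hx0.symm)
      omega
    have hky : π.getVert k ≠ y := fun h => by
      have := hπ.getVert_injOn (x₁ := k) (x₂ := π.length) hk.le (le_refl π.length) (h.trans hyl.symm)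
      omega
    rcases lt_or_gt_of_ne hkx with h | h
    · exact .inl ⟨h, h2 (h.trans hxy)⟩
    · rcases lt_or_gt_of_ne hky with h' | h'
      · exact absurd ((h2 h').trans (h1 h)) (not_le.2 hij)
      · exact .inr ⟨h', h1 h⟩
  let l : Fin (π.length + 1) → X₀ := fun k => c (π.getVert k)
  have hl0 : l 0 = i := by simp [l, hcx]
  have hll : l (Fin.last _) = j := by simp [l, hcy]
  -- The labels `l` found in `d` are those of the leading monomial, so `κ` is `l` with its ends
  -- exchanged back.
  refine ⟨x, y, π, swapEnds l, ⟨hπ, hxy, ?_, ?_⟩, ⟨?_, ?_⟩, ?_⟩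
  · exact fun k h0 hk => (hinner k h0 hk).imp And.left And.left
  · intro τ hτ hss
    have hlt : τ.length < π.length := by
      have h1 := Finset.card_lt_card (s := τ.support.toFinset) (t := π.support.toFinset)
        (by rw [← Finset.coe_ssubset]; simpa using hss)
      rw [List.toFinset_card_of_nodup hτ.support_nodup, List.toFinset_card_of_nodup hπ.support_nodup,
        τ.length_support, π.length_support] at h1
      omega
    exact hmin _ hlt ⟨x, y, i, j, τ, rfl, fun v hv => hocc v (hss.1 hv), hxy, hij, hi, hj⟩
  · have hpos : ∀ k : Fin (π.length + 1), k ≠ 0 → k ≠ Fin.last _ → 0 < k.1 ∧ k.1 < π.length :=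
      fun k h0 hk => ⟨Fin.pos_iff_ne_zero.2 h0, Fin.lt_last_iff_ne_last.2 hk⟩
    intro s t hst
    by_cases hs0 : s = 0
    · subst hs0
      rw [swapEnds_zero, hll]
      by_cases ht0 : t = 0
      · exact absurd hst (by simp [ht0])
      by_cases htl : t = Fin.last _
      · rw [htl, swapEnds_last, hl0]; exact hij.le
      rw [swapEnds_of_ne _ ht0 htl]
      rw [Fin.val_zero, hx0] at hst
      obtain ⟨h1, h2⟩ := hpos t ht0 htl
      rcases hinner t h1 h2 with h | h
      · exact absurd hst h.1.not_gt
      · exact h.2.trans hij.le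
    by_cases hsl : s = Fin.last _
    · subst hsl
      rw [swapEnds_last, hl0]
      rw [Fin.val_last, hyl] at hst
      by_cases ht0 : t = 0
      · exact absurd hst (by simpa [ht0] using hxy.le)
      by_cases htl : t = Fin.last _
      · exact absurd hst (by simp [htl])
      rw [swapEnds_of_ne _ ht0 htl]
      obtain ⟨h1, h2⟩ := hpos t ht0 htl
      rcases hinner t h1 h2 with h | h
      · exact absurd (hst.trans h.1) hxy.not_gt
      · exact h.2
    obtain ⟨s0, s1⟩ := hpos s hs0 hsl
    rw [swapEnds_of_ne _ hs0 hsl]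
    by_cases ht0 : t = 0
    · subst ht0
      rw [swapEnds_zero, hll]
      rw [Fin.val_zero, hx0] at hst
      rcases hinner s s0 s1 with h | h
      · exact h.2
      · exact absurd (hst.trans hxy) h.1.not_gt
    by_cases htl : t = Fin.last _
    · subst htl
      rw [swapEnds_last, hl0]
      rw [Fin.val_last, hyl] at hst
      rcases hinner s s0 s1 with h | h
      · exact hij.le.trans h.2
      · exact absurd hst h.1.not_gt
    obtain ⟨t0, t1⟩ := hpos t ht0 htl
    rw [swapEnds_of_ne _ ht0 htl]
    exact hanti s t s1.le t1.le (by omega) (by omega) hst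
  · rw [swapEnds_last, swapEnds_zero, hl0, hll]
    exact hij
  · have hinv : swapEnds (swapEnds l) = l := by
      funext k
      simp [swapEnds]
    rw [hinv]
    exact placement_le hπ fun k => hc _ (π.getVert_mem_support _)

end Inversion

end BinomialEdge

/-! ### Reducedness, and the theorem -/

namespace BinomialEdge

open scoped MonomialOrder

variable {X₀ V : Type*} [LinearOrder X₀] [LinearOrder V] {G : SimpleGraph V}

/-- The inversion at the ends of `π'` would pass to the multiple, whose labels are antitone. -/
lemma not_placement_swapEnds_le_of_antitone {x y x' y' : V} {π : G.Walk x y} {π' : G.Walk x' y'}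
    {κ : Fin (π.length + 1) → X₀} {κ' : Fin (π'.length + 1) → X₀} (hκ : IsAntitone π κ)
    (hxy' : x' < y') (hκ' : IsStrictlyAntitone π' κ') :
    ¬ placement π' (swapEnds κ') ≤ placement π κ := by
  intro hle
  have hmem : ∀ k, ∃ s, κ s = swapEnds κ' k ∧ π.getVert s = π'.getVert k := fun k =>
    placement_ne_zero_iff.1 (((Nat.pos_iff_ne_zero.2
      (placement_ne_zero_iff.2 ⟨k, rfl, rfl⟩)).trans_le (hle _)).ne')
  obtain ⟨s, hs, hsx⟩ := hmem 0
  obtain ⟨t, ht, hty⟩ := hmem (Fin.last _)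
  simp only [Fin.val_zero, Fin.val_last, SimpleGraph.Walk.getVert_zero,
    SimpleGraph.Walk.getVert_length, swapEnds_zero, swapEnds_last] at hs hsx ht hty
  have := hκ s t (by rwa [hsx, hty])
  rw [hs, ht] at this
  exact hκ'.2.not_ge this

/-- Inner vertices below `x` carry labels at least `κ 0`, those above `y` labels at most the last
value of `κ`, so exchanging the end labels creates no inversion with an inner vertex. -/
lemma eq_ends_of_swapEnds_lt {x y : V} {π : G.Walk x y} {κ : Fin (π.length + 1) → X₀}
    (hπ : IsAdmissible π) (hκ : IsStrictlyAntitone π κ) {s t : Fin (π.length + 1)}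
    (hst : π.getVert s < π.getVert t) (hlt : swapEnds κ s < swapEnds κ t) :
    s = 0 ∧ t = Fin.last _ := by
  have hx0 := π.getVert_zero
  have hyl := π.getVert_length
  have hxy := hπ.lt
  have hinner : ∀ k : Fin (π.length + 1), k ≠ 0 → k ≠ Fin.last _ →
      (π.getVert k < x ∧ κ 0 ≤ κ k) ∨ (y < π.getVert k ∧ κ k ≤ κ (Fin.last _)) := by
    intro k h0 hl
    rcases hπ.inner k (Fin.pos_iff_ne_zero.2 h0) (Fin.lt_last_iff_ne_last.2 hl) with h | h
    · exact .inl ⟨h, hκ.1 k 0 (by simpa using h)⟩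
    · exact .inr ⟨h, hκ.1 (Fin.last _) k (by simpa using h)⟩
  have hends := hκ.2
  by_cases hs0 : s = 0
  · refine ⟨hs0, ?_⟩
    subst hs0
    by_contra htl
    by_cases ht0 : t = 0
    · exact absurd hst (by simp [ht0])
    rw [swapEnds_zero, swapEnds_of_ne _ ht0 htl] at hlt
    rw [Fin.val_zero, hx0] at hst
    rcases hinner t ht0 htl with h | h
    · exact h.1.not_gt hst
    · exact h.2.not_gt hlt
  exfalso
  by_cases hsl : s = Fin.last _
  · subst hsl
    rw [Fin.val_last, hyl] at hst
    by_cases ht0 : t = 0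
    · exact absurd hst (by simpa [ht0] using hxy.le)
    by_cases htl : t = Fin.last _
    · exact absurd hst (by simp [htl])
    rw [swapEnds_last, swapEnds_of_ne _ ht0 htl] at hlt
    rcases hinner t ht0 htl with h | h
    · exact (hst.trans h.1).not_gt hxy
    · exact (h.2.trans_lt hends).not_gt hlt
  rw [swapEnds_of_ne _ hs0 hsl] at hlt
  by_cases ht0 : t = 0
  · subst ht0
    rw [swapEnds_zero] at hlt
    rw [Fin.val_zero, hx0] at hst
    rcases hinner s hs0 hsl with h | h
    · exact (hends.trans_le h.2).not_gt hlt
    · exact (hst.trans hxy).not_gt h.1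
  by_cases htl : t = Fin.last _
  · subst htl
    rw [swapEnds_last] at hlt
    rw [Fin.val_last, hyl] at hst
    rcases hinner s hs0 hsl with h | h
    · exact h.2.not_gt hlt
    · exact h.1.not_gt hst
  rw [swapEnds_of_ne _ ht0 htl] at hlt
  exact (hκ.1 s t hst).not_gt hlt

/-- The inversion at the ends of `π'` must be the one at the ends of `π`, so the ends and their
labels agree. Minimality of `π` then gives equal vertex sets, hence equal leading monomials.
Cancelling the end unknowns identifies the factors `u`, with no need to compare the paths as walks.
-/
lemma eq_of_placement_swapEnds_le (K : Type*) [Field K] {x y x' y' : V} {π : G.Walk x y}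
    {π' : G.Walk x' y'} {κ : Fin (π.length + 1) → X₀} {κ' : Fin (π'.length + 1) → X₀}
    (hπ : IsAdmissible π) (hπ' : IsAdmissible π') (hκ : IsStrictlyAntitone π κ)
    (hκ' : IsStrictlyAntitone π' κ')
    (hle : placement π' (swapEnds κ') ≤ placement π (swapEnds κ)) :
    u K π' κ' * f K (κ' (Fin.last _)) (κ' 0) x' y' = u K π κ * f K (κ (Fin.last _)) (κ 0) x y := by
  have hmem : ∀ k, ∃ s, swapEnds κ s = swapEnds κ' k ∧ π.getVert s = π'.getVert k := fun k =>
    placement_ne_zero_iff.1 (((Nat.pos_iff_ne_zero.2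
      (placement_ne_zero_iff.2 ⟨k, rfl, rfl⟩)).trans_le (hle _)).ne')
  obtain ⟨s, hs, hsx⟩ := hmem 0
  obtain ⟨t, ht, hty⟩ := hmem (Fin.last _)
  have hst : s = 0 ∧ t = Fin.last _ := by
    refine eq_ends_of_swapEnds_lt hπ hκ ?_ ?_
    · rw [hsx, hty]
      simpa using hπ'.lt
    · rw [hs, ht]
      simpa using hκ'.2
  obtain ⟨rfl, rfl⟩ := hst
  simp only [Fin.val_zero, Fin.val_last, SimpleGraph.Walk.getVert_zero,
    SimpleGraph.Walk.getVert_length, swapEnds_zero, swapEnds_last] at hs hsx ht hty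
  subst hsx hty
  have hsub : ∀ v ∈ π'.support, v ∈ π.support := by
    intro v hv
    obtain ⟨k, rfl, hk⟩ := SimpleGraph.Walk.mem_support_iff_exists_getVert.1 hv
    obtain ⟨s, -, hs⟩ := hmem ⟨k, Nat.lt_succ_of_le hk⟩
    exact hs ▸ π.getVert_mem_support _
  have hsup : ∀ v ∈ π.support, v ∈ π'.support := by
    intro v hv
    by_contra hv'
    exact hπ.minimal π' hπ'.isPath ⟨hsub, fun h => hv' (h hv)⟩
  have heq : placement π' (swapEnds κ') = placement π (swapEnds κ) := by
    refine le_antisymm hle (placement_le hπ.isPath fun k => ?_)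
    obtain ⟨k', hk', hl⟩ := SimpleGraph.Walk.mem_support_iff_exists_getVert.1
      (hsup _ (π.getVert_mem_support k))
    obtain ⟨s, hs, hs'⟩ := hmem ⟨k', Nat.lt_succ_of_le hl⟩
    obtain rfl : s = k := Fin.ext (hπ.isPath.getVert_injOn (Nat.lt_succ_iff.1 s.2)
      (Nat.lt_succ_iff.1 k.2) (hs'.trans hk'))
    exact placement_ne_zero_iff.2 ⟨_, hs.symm, hk'⟩
  have h := u_mul_ends π K hπ.lt.ne (swapEnds_eq_of_mem_Ioo κ)
  rw [← heq, ← u_mul_ends π' K hπ.lt.ne (swapEnds_eq_of_mem_Ioo κ')] at h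
  simp only [swapEnds_zero, swapEnds_last, ← hs, ← ht] at h
  rw [hs, ht] at *
  rw [mul_right_cancel₀ (mul_ne_zero (X_ne_zero _) (X_ne_zero _)) h]

theorem isReducedGroebnerBasis_pathBinomials [Finite X₀] [Finite V] (K : Type*) [Field K]
    (G : SimpleGraph V) :
    GroebnerBasis.IsReducedGroebnerBasis (MonomialOrder.lex : MonomialOrder (Var X₀ V))
      (edgeIdeal K X₀ G) (pathBinomials K X₀ G) := by
  classical
  have := Fintype.ofFinite X₀
  have := Fintype.ofFinite V
  have hsub : pathBinomials K X₀ G ⊆ edgeIdeal K X₀ G := by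
    rintro _ ⟨x, y, π, κ, hπ, -, rfl⟩
    exact u_mul_f_mem K hπ.lt.ne π κ _ _
  refine ⟨⟨pathBinomials_finite K, hsub, le_antisymm (Ideal.span_mono (Set.image_mono hsub))
    (Ideal.span_le.2 ?_)⟩, ?_, ?_⟩
  · rintro _ ⟨g, hg, rfl⟩
    rcases eq_or_ne g 0 with rfl | hg0
    · simp
    obtain ⟨n, hn, hne, hinv⟩ :=
      exists_mem_support_ne hg (MonomialOrder.lex.degree_mem_support hg0)
    -- The second monomial `n` of the class lies strictly below the leading one.
    obtain ⟨x, y, i, j, hxy, hij, hi, hj, w, hw⟩ := exists_inversion_of_lt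
      (lt_of_le_of_ne (MonomialOrder.lex.le_degree hn) fun h =>
        hne (MonomialOrder.lex.toSyn.injective h)) hinv
    have hocc : ∀ v ∈ w.support, ∃ k, MonomialOrder.lex.degree g (var k v) ≠ 0 := fun v hv => by
      by_contra! h
      exact hw v hv (Finset.sum_eq_zero fun k _ => h k)
    obtain ⟨x, y, π, κ, hπ, hκ, hle⟩ :=
      exists_placement_le ⟨x, y, i, j, w, rfl, hocc, hxy, hij, hi, hj⟩
    have hb : MonomialOrder.lex.leadingTerm (u K π κ * f K (κ (Fin.last π.length)) (κ 0) x y) =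
        monomial (placement π (swapEnds κ)) 1 := by
      rw [MonomialOrder.leadingTerm, degree_u_mul_f π K hπ.lt hκ.2,
        leadingCoeff_u_mul_f π K hπ.lt hκ.2]
    have hlt : MonomialOrder.lex.leadingTerm g =
        monomial (MonomialOrder.lex.degree g - placement π (swapEnds κ))
          (MonomialOrder.lex.leadingCoeff g) * monomial (placement π (swapEnds κ)) 1 := by
      rw [monomial_mul, mul_one, tsub_add_cancel_of_le hle, MonomialOrder.leadingTerm]
    rw [hlt, ← hb]
    exact Ideal.mul_mem_left _ _
      (Ideal.subset_span (Set.mem_image_of_mem _ ⟨x, y, π, κ, hπ, hκ, rfl⟩))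
  · rintro _ ⟨x, y, π, κ, hπ, hκ, rfl⟩
    exact leadingCoeff_u_mul_f π K hπ.lt hκ.2
  · rintro _ ⟨x, y, π, κ, hπ, hκ, rfl⟩ _ ⟨x', y', π', κ', hπ', hκ', rfl⟩ hne d hd hle
    rw [degree_u_mul_f π' K hπ'.lt hκ'.2] at hle
    rw [u_mul_f π K hπ.lt.ne] at hd
    have hd' := support_sub _ _ _ hd
    rw [Finset.mem_union, support_monomial, support_monomial, if_neg one_ne_zero,
      if_neg one_ne_zero, Finset.mem_singleton, Finset.mem_singleton] at hd'
    rcases hd' with rfl | rfl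
    · exact hne (eq_of_placement_swapEnds_le K hπ hπ' hκ hκ' hle)
    · exact not_placement_swapEnds_le_of_antitone hκ.1 hπ'.lt hκ' hle

end BinomialEdge

theorem theorem2p1 {X₀ V K : Type*} [LinearOrder X₀] [Finite X₀] [LinearOrder V] [Finite V]
    [Field K] (G : SimpleGraph V) :
    GroebnerBasis.IsReducedGroebnerBasis
      (MonomialOrder.lex : MonomialOrder (BinomialEdge.Var X₀ V))
      (BinomialEdge.edgeIdeal K X₀ G) (BinomialEdge.pathBinomials K X₀ G) :=
  BinomialEdge.isReducedGroebnerBasis_pathBinomials K G
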